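/- **Proposition 2.1 (injective envelope).** Let $n\ge 0$ and let $\mathcal D=\mathbb C[\partial_1,\dots,\partial_n]$ act on $\mathcal C^\infty(\mathbb R^n)$ (smooth functions $\mathbb R^n\to\mathbb C$) as the ring of differential operators with constant coefficients. For an integer $N\ge 1$ identify $\mathcal C^\infty(\mathbb R^n/2\pi N\mathbb Z^n)$ with the space of functions in $\mathcal C^\infty(\mathbb R^n)$ that are periodic with respect to $2\pi N\mathbb Z^n$. Each such function is the sum of its Fourier series $\sum_{a\in\frac1N\mathbb Z^n}c_ae^{i\langle a,x\rangle}$ with rapidly decreasing coefficients $c_a$; its support is $\{a : c_a\neq 0\}$. Let $\mathbb T=\mathbb R^n/2\pi\mathbb Z^n$, let $\mathbb P\mathbb T=\varprojlim_N \mathbb R^n/2\pi N\mathbb Z^n$ be the protorus, and put $$\mathcal C^\infty(\mathbb P\mathbb T)=\bigcup_{N\ge1}\mathcal C^\infty(\mathbb R^n/2\pi N\mathbb Z^n)\subset\mathcal C^\infty(\mathbb R^n).$$ Let $\mathcal C^\infty(\mathbb T)_{\rm fin}$ and $\mathcal C^\infty(\mathbb P\mathbb T)_{\rm fin}$ be the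 $\mathcal D$-submodules of $\mathcal C^\infty(\mathbb T)$ and $\mathcal C^\infty(\mathbb P\mathbb T)$ that consist of the functions with finite support. For either of these modules $\mathcal F$, let $\mathcal F[x_1,\dots,x_n]$ be the subalgebra of $\mathcal C^\infty(\mathbb R^n)$ generated by $\mathcal F$ and the coordinate functions $x_1,\dots,x_n$; it is a $\mathcal D$-submodule of $\mathcal C^\infty(\mathbb R^n)$. Then the inclusion $\mathcal C^\infty(\mathbb P\mathbb T)_{\rm fin}\subset\mathcal C^\infty(\mathbb P\mathbb T)_{\rm fin}[x_1,\dots,x_n]$ is an injective envelope of the $\mathcal D$-module $\mathcal C^\infty(\mathbb P\mathbb T)_{\rm fin}$, and likewise the inclusion $\mathcal C^\infty(\mathbb T)_{\rm fin}\subset\mathcal C^\infty(\mathbb T)_{\rm fin}[x_1,\dots,x_n]$ is an injective envelope of the $\mathcal D$-module $\mathcal C^\infty(\mathbb T)_{\rm fin}$. That is, in both cases the larger module is an injective $\mathcal D$-module, and each of its nonzero $\mathcal D$-submodules has nonzero intersection with the smaller module. -/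

import Mathlib

noncomputable section

namespace PeriodicBehavior

open scoped ContDiff

/-! ### Smooth functions on `ℝⁿ` and the ring of constant coefficient operators -/

/-- `C^∞(ℝⁿ)`: the algebra of smooth complex valued functions on `ℝⁿ`. -/
def smooth (n : ℕ) : Subalgebra ℂ ((Fin n → ℝ) → ℂ) where
  carrier := {f | ContDiff ℝ ∞ f}
  mul_mem' {f g} (hf : ContDiff ℝ ∞ f) (hg : ContDiff ℝ ∞ g) := hf.mul hg
  add_mem' {f g} (hf : ContDiff ℝ ∞ f) (hg : ContDiff ℝ ∞ g) := hf.add hg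
  algebraMap_mem' c := (contDiff_const : ContDiff ℝ ∞ fun _ : Fin n → ℝ => c)

lemma contDiff_smooth {n : ℕ} (f : smooth n) : ContDiff ℝ ∞ f.1 := f.2

lemma differentiableAt_smooth {n : ℕ} (f : smooth n) (x : Fin n → ℝ) :
    DifferentiableAt ℝ f.1 x := (contDiff_smooth f).differentiable (by simp) x

/-- The partial derivative `∂ⱼ` as a `ℂ`-linear operator on `C^∞(ℝⁿ)`. -/
def partialDeriv {n : ℕ} (j : Fin n) : Module.End ℂ (smooth n) where
  toFun f := ⟨fun x => fderiv ℝ f.1 x (Pi.single j 1),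
    ((contDiff_smooth f).fderiv_right (m := ∞) (by simp)).clm_apply contDiff_const⟩
  map_add' f g := by
    ext x
    have hf : DifferentiableAt ℝ f.1 x := differentiableAt_smooth f x
    have hg : DifferentiableAt ℝ g.1 x := differentiableAt_smooth g x
    have h := fderiv_add hf hg
    change fderiv ℝ (f.1 + g.1) x (Pi.single j 1) = _
    rw [h]; rfl
  map_smul' c f := by
    ext x
    have hf : DifferentiableAt ℝ f.1 x := differentiableAt_smooth f x
    have h := fderiv_const_smul hf c
    change fderiv ℝ (c • f.1) x (Pi.single j 1) = _
    rw [h]; rfl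

lemma partialDeriv_apply {n : ℕ} (j : Fin n) (f : smooth n) (x : Fin n → ℝ) :
    (partialDeriv j f).1 x = fderiv ℝ f.1 x (Pi.single j 1) := rfl

lemma partialDeriv_comm {n : ℕ} (i j : Fin n) :
    partialDeriv i * partialDeriv j = partialDeriv j * partialDeriv i := by
  have key : ∀ (i j : Fin n) (f : smooth n) (x : Fin n → ℝ),
      (partialDeriv i (partialDeriv j f)).1 x
        = fderiv ℝ (fderiv ℝ f.1) x (Pi.single i 1) (Pi.single j 1) := by
    intro i j f x
    have hd : DifferentiableAt ℝ (fderiv ℝ f.1) x :=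
      (((contDiff_smooth f).fderiv_right (m := ∞) (by simp)).differentiable (by simp)) x
    rw [partialDeriv_apply]
    change fderiv ℝ (fun y => fderiv ℝ f.1 y (Pi.single j 1)) x (Pi.single i 1) = _
    rw [fderiv_clm_apply hd (differentiableAt_const _)]
    simp
  ext f x
  change (partialDeriv i (partialDeriv j f)).1 x = (partialDeriv j (partialDeriv i f)).1 x
  rw [key, key]
  have hf : ContDiffAt ℝ ∞ f.1 x := (contDiff_smooth f).contDiffAt
  exact (hf.isSymmSndFDerivAt (by
    rw [minSmoothness_of_isRCLikeNormedField]
    exact WithTop.coe_le_coe.mpr (le_top : (2 : ℕ∞) ≤ ⊤))).eq _ _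

/-- The algebra of operators on `C^∞(ℝⁿ)` generated by the `∂ⱼ`. -/
def opAlgebra (n : ℕ) : Subalgebra ℂ (Module.End ℂ (smooth n)) :=
  Algebra.adjoin ℂ (Set.range (partialDeriv (n := n)))

instance opAlgebra_isMulCommutative (n : ℕ) : IsMulCommutative (opAlgebra n) :=
  Algebra.isMulCommutative_adjoin ℂ (by
    rintro _ ⟨i, rfl⟩ _ ⟨j, rfl⟩
    exact partialDeriv_comm i j)

/-- `𝒟 = ℂ[∂₁, …, ∂ₙ]`; the variable `X j` stands for `∂ⱼ`. As the `∂ⱼ` are algebraically independent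
operators, this polynomial ring is the ring of constant coefficient operators. -/
abbrev Diff (n : ℕ) : Type := MvPolynomial (Fin n) ℂ

open scoped IsMulCommutative in
/-- The operator on `C^∞(ℝⁿ)` given by a polynomial in the `∂ⱼ`. -/
def toOp (n : ℕ) : Diff n →ₐ[ℂ] Module.End ℂ (smooth n) :=
  (opAlgebra n).val.comp
    (MvPolynomial.aeval fun j =>
      (⟨partialDeriv j, Algebra.subset_adjoin ⟨j, rfl⟩⟩ : opAlgebra n))

lemma toOp_X {n : ℕ} (j : Fin n) : toOp n (MvPolynomial.X j) = partialDeriv j := by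
  simp only [toOp, AlgHom.comp_apply, MvPolynomial.aeval_X, Subalgebra.coe_val]

/-- `C^∞(ℝⁿ)` is a `𝒟`-module: a polynomial acts as the corresponding differential operator. -/
instance smoothModule (n : ℕ) : Module (Diff n) (smooth n) :=
  Module.compHom (smooth n) (toOp n).toRingHom

lemma smul_def {n : ℕ} (p : Diff n) (f : smooth n) : p • f = toOp n p f := rfl

/-- A `ℂ`-subspace of `C^∞(ℝⁿ)` that is stable under all `∂ⱼ`, as a `𝒟`-submodule. -/
def ofStable {n : ℕ} (S : Submodule ℂ (smooth n))
    (hS : ∀ j, ∀ f ∈ S, partialDeriv j f ∈ S) : Submodule (Diff n) (smooth n) where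
  carrier := S
  add_mem' := S.add_mem
  zero_mem' := S.zero_mem
  smul_mem' p f hf := by
    rw [smul_def]
    change toOp n p f ∈ S
    replace hf : f ∈ S := hf
    induction p using MvPolynomial.induction_on generalizing f with
    | C c =>
      rw [show (MvPolynomial.C c : Diff n) = algebraMap ℂ _ c from rfl, AlgHom.commutes]
      exact S.smul_mem c hf
    | add p q hp hq =>
      rw [map_add]
      exact S.add_mem (hp f hf) (hq f hf)
    | mul_X p j hp =>
      rw [map_mul, toOp_X]
      exact hp _ (hS j f hf)

@[simp] lemma mem_ofStable {n : ℕ} (S : Submodule ℂ (smooth n))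
    (hS : ∀ j, ∀ f ∈ S, partialDeriv j f ∈ S) (f : smooth n) :
    f ∈ ofStable S hS ↔ f ∈ S := Iff.rfl

/-! ### Periodic functions, Fourier series, finite support -/

/-- `f` is invariant under translation by the lattice `2πNℤⁿ`. -/
def IsPeriodic {n : ℕ} (N : ℕ) (f : (Fin n → ℝ) → ℂ) : Prop :=
  ∀ (x : Fin n → ℝ) (m : Fin n → ℤ), f (fun j => x j + 2 * Real.pi * N * m j) = f x

/-- `c` is the family of coefficients of a Fourier series `∑ c_a e^{i⟨a,x⟩}` of a smooth function
on `ℝⁿ/2πNℤⁿ`, and the sum of the series is `f`: the frequencies `a ∈ ℚⁿ` with `c_a ≠ 0` lie in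
`(1/N)ℤⁿ`, the coefficients decrease rapidly, and the series sums to `f` everywhere. -/
def HasFourierSeries {n : ℕ} (N : ℕ) (f : (Fin n → ℝ) → ℂ) (c : (Fin n → ℚ) → ℂ) : Prop :=
  (∀ a, c a ≠ 0 → ∀ j, ∃ m : ℤ, (N : ℚ) * a j = m) ∧
  (∀ k : ℕ, ∃ C : ℝ, 0 < C ∧ ∀ a, ‖c a‖ ≤ C / (1 + ∑ j, |(a j : ℝ)|) ^ k) ∧
  ∀ x, HasSum (fun a => c a * Complex.exp (Complex.I * ∑ j, (a j : ℂ) * (x j : ℂ))) (f x)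

/-- `f` is the sum of a Fourier series with frequencies in `(1/N)ℤⁿ` and finite support. -/
def HasFiniteSupport {n : ℕ} (N : ℕ) (f : (Fin n → ℝ) → ℂ) : Prop :=
  ∃ c : (Fin n → ℚ) → ℂ, HasFourierSeries N f c ∧ (Function.support c).Finite

/-- `C^∞(ℝⁿ/2πℤⁿ)`, as a subspace of `C^∞(ℝⁿ)`. -/
def torus (n : ℕ) : Set (smooth n) := {f | IsPeriodic 1 f.1}

/-- `C^∞` of the protorus, as a subspace of `C^∞(ℝⁿ)`: the union over `N ≥ 1` of the spaces
`C^∞(ℝⁿ/2πNℤⁿ)`. -/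
def protorus (n : ℕ) : Set (smooth n) := {f | ∃ N : ℕ, 1 ≤ N ∧ IsPeriodic N f.1}

lemma IsPeriodic.mul_left {n N : ℕ} {f : (Fin n → ℝ) → ℂ} (h : IsPeriodic N f) (M : ℕ) :
    IsPeriodic (M * N) f := by
  intro x m
  have := h x (fun j => M * m j)
  rw [← this]
  congr 1
  ext j
  push_cast
  ring

lemma IsPeriodic.add {n N : ℕ} {f g : (Fin n → ℝ) → ℂ} (hf : IsPeriodic N f)
    (hg : IsPeriodic N g) : IsPeriodic N (f + g) := fun x m => by
  simp only [Pi.add_apply, hf x m, hg x m]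

lemma IsPeriodic.const_smul {n N : ℕ} {f : (Fin n → ℝ) → ℂ} (hf : IsPeriodic N f) (c : ℂ) :
    IsPeriodic N (c • f) := fun x m => by
  simp only [Pi.smul_apply, hf x m]

lemma IsPeriodic.partialDeriv {n N : ℕ} {f : smooth n} (hf : IsPeriodic N f.1) (j : Fin n) :
    IsPeriodic N (partialDeriv j f).1 := by
  intro x m
  have h : (fun y : Fin n → ℝ => f.1 (y + fun j => 2 * Real.pi * N * m j)) = f.1 :=
    funext fun y => hf y m
  have h2 := fderiv_comp_add_right (𝕜 := ℝ) (f := f.1) (x := x)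
    (fun j => 2 * Real.pi * N * (m j : ℝ))
  rw [h] at h2
  rw [partialDeriv_apply, partialDeriv_apply, h2]
  rfl

/-- The exponential `e^{i⟨a,x⟩}`. -/
def expFun {n : ℕ} (a : Fin n → ℚ) (x : Fin n → ℝ) : ℂ :=
  Complex.exp (Complex.I * ∑ j, (a j : ℂ) * (x j : ℂ))

/-- Finite support means being a finite sum of exponentials. -/
lemma hasFiniteSupport_iff {n N : ℕ} {f : (Fin n → ℝ) → ℂ} :
    HasFiniteSupport N f ↔ ∃ c : (Fin n → ℚ) →₀ ℂ,
      (∀ a, c a ≠ 0 → ∀ j, ∃ m : ℤ, (N : ℚ) * a j = m) ∧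
      ∀ x, f x = ∑ a ∈ c.support, c a * expFun a x := by
  constructor
  · rintro ⟨c, ⟨h1, -, h3⟩, hc⟩
    refine ⟨Finsupp.ofSupportFinite c hc, h1, fun x => ?_⟩
    refine (h3 x).unique (hasSum_sum_of_ne_finset_zero fun a ha => ?_)
    have : c a = 0 := by
      by_contra h
      exact ha (by rw [Finsupp.mem_support_iff]; exact h)
    rw [this, zero_mul]
  · rintro ⟨c, h1, h3⟩
    refine ⟨c, ⟨h1, fun k => ?_, fun x => ?_⟩, c.hasFiniteSupport⟩
    · refine ⟨1 + ∑ b ∈ c.support, ‖c b‖ * (1 + ∑ j, |(b j : ℝ)|) ^ k, by positivity, fun a => ?_⟩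
      rw [le_div_iff₀ (by positivity)]
      by_cases ha : a ∈ c.support
      · have := Finset.single_le_sum
          (f := fun b : Fin n → ℚ => ‖c b‖ * (1 + ∑ j, |(b j : ℝ)|) ^ k)
          (fun b _ => by positivity) ha
        linarith
      · rw [Finsupp.notMem_support_iff.mp ha, norm_zero, zero_mul]
        positivity
    · rw [h3 x]
      refine hasSum_sum_of_ne_finset_zero fun a ha => ?_
      rw [Finsupp.notMem_support_iff.mp ha, zero_mul]

lemma HasFiniteSupport.mul_left {n N : ℕ} {f : (Fin n → ℝ) → ℂ} (h : HasFiniteSupport N f)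
    (M : ℕ) : HasFiniteSupport (M * N) f := by
  obtain ⟨c, ⟨h1, h2, h3⟩, hc⟩ := h
  refine ⟨c, ⟨fun a ha j => ?_, h2, h3⟩, hc⟩
  obtain ⟨m, hm⟩ := h1 a ha j
  exact ⟨M * m, by push_cast; rw [mul_assoc, hm]⟩

lemma HasFiniteSupport.add {n N : ℕ} {f g : (Fin n → ℝ) → ℂ} (hf : HasFiniteSupport N f)
    (hg : HasFiniteSupport N g) : HasFiniteSupport N (f + g) := by
  rw [hasFiniteSupport_iff] at *
  obtain ⟨c, hc, hfc⟩ := hf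
  obtain ⟨d, hd, hgd⟩ := hg
  refine ⟨c + d, fun a ha => ?_, fun x => ?_⟩
  · by_cases h : c a = 0
    · exact hd a (by simpa [h] using ha)
    · exact hc a h
  · rw [Pi.add_apply, hfc, hgd]
    have := Finsupp.sum_add_index' (f := c) (g := d) (h := fun a z => z * expFun a x)
      (by simp) (by intros; ring)
    exact this.symm

lemma HasFiniteSupport.const_smul {n N : ℕ} {f : (Fin n → ℝ) → ℂ} (hf : HasFiniteSupport N f)
    (z : ℂ) : HasFiniteSupport N (z • f) := by
  obtain ⟨c, ⟨h1, h2, h3⟩, hc⟩ := hf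
  refine ⟨z • c, ⟨fun a ha => h1 a fun h => ha (by simp [h]), fun k => ?_, fun x => ?_⟩,
    hc.subset (Function.support_const_smul_subset z c)⟩
  · obtain ⟨C, hC, h⟩ := h2 k
    refine ⟨(‖z‖ + 1) * C, by positivity, fun a => ?_⟩
    rw [Pi.smul_apply, norm_smul, mul_div_assoc]
    exact mul_le_mul (by linarith) (h a) (norm_nonneg _) (by positivity)
  · simpa [mul_assoc] using (h3 x).mul_left z

lemma hasFiniteSupport_zero {n N : ℕ} : HasFiniteSupport N (0 : (Fin n → ℝ) → ℂ) :=
  hasFiniteSupport_iff.mpr ⟨0, by simp, by simp⟩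

lemma hasFDerivAt_expFun {n : ℕ} (a : Fin n → ℚ) (x : Fin n → ℝ) :
    ∃ L : (Fin n → ℝ) →L[ℝ] ℂ, HasFDerivAt (expFun a) L x ∧
      ∀ j, L (Pi.single j 1) = Complex.I * (a j : ℂ) * expFun a x := by
  let ℓ : (Fin n → ℝ) →L[ℝ] ℂ :=
    Complex.I • ∑ j, (a j : ℂ) • (Complex.ofRealCLM ∘L ContinuousLinearMap.proj j)
  have hℓ : ∀ y, ℓ y = Complex.I * ∑ j, (a j : ℂ) * (y j : ℂ) := by
    intro y
    simp [ℓ]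
  have h : HasFDerivAt (fun y => Complex.exp (ℓ y)) (Complex.exp (ℓ x) • ℓ) x :=
    ℓ.hasFDerivAt.cexp
  have he : (fun y => Complex.exp (ℓ y)) = expFun a := by
    ext y; rw [hℓ]; rfl
  rw [he] at h
  refine ⟨_, h, fun j => ?_⟩
  rw [smul_apply, hℓ (Pi.single j 1), hℓ x]
  have : ∑ i, (a i : ℂ) * ((Pi.single j (1 : ℝ) : Fin n → ℝ) i : ℂ) = a j := by
    rw [Finset.sum_eq_single j]
    · simp
    · intro i _ hij
      simp [hij]
    · simp
  rw [this, smul_eq_mul, mul_comm]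
  rfl

lemma HasFiniteSupport.partialDeriv {n N : ℕ} {f : smooth n} (hf : HasFiniteSupport N f.1)
    (j : Fin n) : HasFiniteSupport N (partialDeriv j f).1 := by
  rw [hasFiniteSupport_iff] at *
  obtain ⟨c, hc, hfc⟩ := hf
  choose L hL hLj using fun (a : Fin n → ℚ) (x : Fin n → ℝ) => hasFDerivAt_expFun a x
  refine ⟨c.mapRange id rfl |>.zipWith (fun z w => z * w) (by simp)
    (Finsupp.onFinset c.support (fun a => if c a = 0 then 0 else Complex.I * (a j : ℂ))
      (by intro a; simp +contextual)), fun a ha => ?_, fun x => ?_⟩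
  · refine hc a fun h => ha ?_
    simp [h]
  · have hd : HasFDerivAt f.1 (∑ a ∈ c.support, c a • L a x) x := by
      have : f.1 = fun y => ∑ a ∈ c.support, c a * expFun a y := funext hfc
      rw [this]
      exact HasFDerivAt.fun_sum fun a _ => (hL a x).const_mul (c a)
    rw [partialDeriv_apply, hd.fderiv]
    symm
    rw [Finset.sum_subset (s₂ := c.support)]
    · rw [sum_apply]
      refine Finset.sum_congr rfl fun a ha => ?_
      have ha' : c a ≠ 0 := Finsupp.mem_support_iff.mp ha
      simp [hLj, ha']
      ring
    · intro a ha
      rw [Finsupp.mem_support_iff] at *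
      intro h
      exact ha (by simp [h])
    · intro a _ ha
      rw [Finsupp.notMem_support_iff.mp ha, zero_mul]

/-- `C^∞(𝕋)_fin`: the `𝒟`-module of smooth functions on the torus `ℝⁿ/2πℤⁿ` with finite support. -/
def torusFin (n : ℕ) : Submodule (Diff n) (smooth n) :=
  ofStable
    { carrier := {f | f ∈ torus n ∧ HasFiniteSupport 1 f.1}
      add_mem' := fun hf hg => ⟨IsPeriodic.add hf.1 hg.1, hf.2.add hg.2⟩
      zero_mem' := ⟨fun _ _ => rfl, hasFiniteSupport_zero⟩
      smul_mem' := fun c _ hf => ⟨IsPeriodic.const_smul hf.1 c, hf.2.const_smul c⟩ }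
    (fun j _ hf => ⟨IsPeriodic.partialDeriv hf.1 j, hf.2.partialDeriv j⟩)

/-- `C^∞(protorus)_fin`: the `𝒟`-module of the elements of `C^∞(protorus)` with finite support. -/
def protorusFin (n : ℕ) : Submodule (Diff n) (smooth n) :=
  ofStable
    { carrier := {f | f ∈ protorus n ∧ ∃ N : ℕ, 1 ≤ N ∧ HasFiniteSupport N f.1}
      add_mem' := by
        rintro f g ⟨⟨N, hN, hf⟩, N', hN', hf'⟩ ⟨⟨M, hM, hg⟩, M', hM', hg'⟩
        refine ⟨⟨M * N, Nat.mul_pos hM hN, (hf.mul_left M).add ?_⟩,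
          M' * N', Nat.mul_pos hM' hN', (hf'.mul_left M').add ?_⟩
        · rw [mul_comm]
          exact hg.mul_left N
        · rw [mul_comm]
          exact hg'.mul_left N'
      zero_mem' := ⟨⟨1, le_rfl, fun _ _ => rfl⟩, 1, le_rfl, hasFiniteSupport_zero⟩
      smul_mem' := by
        rintro c f ⟨⟨N, hN, hf⟩, N', hN', hf'⟩
        exact ⟨⟨N, hN, hf.const_smul c⟩, N', hN', hf'.const_smul c⟩ }
    (by
      rintro j f ⟨⟨N, hN, hf⟩, N', hN', hf'⟩
      exact ⟨⟨N, hN, hf.partialDeriv j⟩, N', hN', hf'.partialDeriv j⟩)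

/-! ### Adjoining the coordinate functions -/

/-- The coordinate function `xⱼ` on `ℝⁿ`. -/
def coord {n : ℕ} (j : Fin n) : smooth n :=
  ⟨fun x => (x j : ℂ), by
    change ContDiff ℝ ∞ (Complex.ofRealCLM ∘ fun x : Fin n → ℝ => x j)
    exact Complex.ofRealCLM.contDiff.comp (contDiff_apply ℝ ℝ j)⟩

lemma partialDeriv_mul {n : ℕ} (j : Fin n) (f g : smooth n) :
    partialDeriv j (f * g) = partialDeriv j f * g + f * partialDeriv j g := by
  ext x
  have hf : DifferentiableAt ℝ f.1 x := differentiableAt_smooth f x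
  have hg : DifferentiableAt ℝ g.1 x := differentiableAt_smooth g x
  change fderiv ℝ (f.1 * g.1) x (Pi.single j 1) = fderiv ℝ f.1 x (Pi.single j 1) * g.1 x
    + f.1 x * fderiv ℝ g.1 x (Pi.single j 1)
  rw [fderiv_mul hf hg]
  simp
  ring

lemma partialDeriv_algebraMap {n : ℕ} (j : Fin n) (c : ℂ) :
    partialDeriv j (algebraMap ℂ (smooth n) c) = 0 := by
  ext x
  change fderiv ℝ (fun _ => c) x (Pi.single j 1) = 0
  simp

lemma partialDeriv_coord {n : ℕ} (i j : Fin n) :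
    partialDeriv j (coord i) = algebraMap ℂ (smooth n) (if i = j then 1 else 0) := by
  ext x
  have h : HasFDerivAt (fun y : Fin n → ℝ => (y i : ℂ))
      (Complex.ofRealCLM ∘L ContinuousLinearMap.proj i) x :=
    (Complex.ofRealCLM ∘L (ContinuousLinearMap.proj i : (Fin n → ℝ) →L[ℝ] ℝ)).hasFDerivAt
  change fderiv ℝ (fun y : Fin n → ℝ => (y i : ℂ)) x (Pi.single j 1) = if i = j then 1 else 0
  rw [h.fderiv]
  by_cases hij : i = j
  · subst hij
    simp
  · simp [hij]

/-- `F[x₁, …, xₙ]`: the subalgebra of `C^∞(ℝⁿ)` generated by `F` and the coordinate functions, as a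
`𝒟`-module. -/
def adjoinCoords {n : ℕ} (F : Submodule (Diff n) (smooth n)) : Submodule (Diff n) (smooth n) :=
  ofStable
    (Subalgebra.toSubmodule
      (Algebra.adjoin ℂ ((F : Set (smooth n)) ∪ Set.range (coord (n := n)))))
    (by
      intro j f hf
      rw [Subalgebra.mem_toSubmodule] at *
      induction hf using Algebra.adjoin_induction with
      | mem g hg =>
        rcases hg with hg | ⟨i, rfl⟩
        · have h := F.smul_mem (MvPolynomial.X j) hg
          rw [smul_def, toOp_X] at h
          exact Algebra.subset_adjoin (Or.inl h)
        · rw [partialDeriv_coord]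
          exact Subalgebra.algebraMap_mem _ _
      | algebraMap c =>
        rw [partialDeriv_algebraMap]
        exact Subalgebra.zero_mem _
      | add g h _ _ hg hh =>
        rw [map_add]
        exact Subalgebra.add_mem _ hg hh
      | mul g h hg' hh' hg hh =>
        rw [partialDeriv_mul]
        exact Subalgebra.add_mem _ (Subalgebra.mul_mem _ hg hh') (Subalgebra.mul_mem _ hg' hh))

lemma le_adjoinCoords {n : ℕ} (F : Submodule (Diff n) (smooth n)) : F ≤ adjoinCoords F :=
  fun _ hf => Algebra.subset_adjoin (Or.inl hf)

/-! ### Injective envelopes -/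

/-- An `R`-linear map `ι : M → E` is an injective envelope of `M`: it is injective, `E` is an
injective module, and `E` is an essential extension of the image of `ι`. -/
structure IsInjectiveEnvelope {R M E : Type} [Ring R] [AddCommGroup M] [Module R M]
    [AddCommGroup E] [Module R E] (ι : M →ₗ[R] E) : Prop where
  injective_map : Function.Injective ι
  injective_module : Module.Injective R E
  essential : ∀ S : Submodule R E, S ⊓ LinearMap.range ι = ⊥ → S = ⊥

end PeriodicBehavior

end

noncomputable section

namespace PeriodicBehavior

open scoped ContDiff
open MvPolynomial

variable {n : ℕ}

/-! Both modules are spanned by the exponentials with frequencies in a monoid `A` (`ℤⁿ` or all of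
`ℚⁿ`), and `IsExpSpan` treats them together. Write 𝔪_a for the maximal ideal generated by the ∂ⱼ - i
aⱼ.

Every element of F[x] is killed by a finite product of powers 𝔪_a^k with a in `A`. Hence a nonzero
submodule has an associated prime that contains some 𝔪_a, so it contains a nonzero joint eigenvector
of the ∂ⱼ, which is a multiple of an exponential (`IsExpSpan.exists_smoothExp_mem`). This is
essentiality.

For injectivity, send f to the functional P ↦ (P f)(0) on 𝒟. On F[x] this is injective: a nonzero
kernel element would generate a submodule containing an exponential, whose value at 0 is 1. Its
image consists of the functionals that vanish on some ∏ 𝔪_a^k (`IsExpSpan.exists_jetAtZero_eq`): at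
one point by the duality of x^α e^{i⟨a,x⟩} with (∂ - i a)^β, in general by the Chinese remainder
theorem. Given φ : I → F[x], some J = ∏ 𝔪_a^k kills its finitely generated image, and by Artin–Rees
φ vanishes on I ∩ J^(m+1). So x ↦ φ(x)(0) extends to a functional on 𝒟 that vanishes on J^(m+1). It
comes from some e in F[x], and φ is multiplication by e; Baer's criterion concludes. -/

lemma C_smul (c : ℂ) (f : smooth n) : (C c : Diff n) • f = c • f := by
  rw [smul_def, show (C c : Diff n) = algebraMap ℂ _ c from rfl, AlgHom.commutes]
  rfl

lemma X_smul (j : Fin n) (f : smooth n) : (X j : Diff n) • f = partialDeriv j f := by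
  rw [smul_def, toOp_X]

lemma smul_smul_comm (p : Diff n) (c : ℂ) (f : smooth n) : p • (c • f) = c • (p • f) := by
  rw [← C_smul, ← C_smul, smul_smul, smul_smul, mul_comm]

/-! ### Exponentials and the operators ∂ⱼ - i aⱼ -/

/-- The exponential `e^{i⟨a,x⟩}` as a smooth function. -/
def smoothExp (a : Fin n → ℚ) : smooth n :=
  ⟨expFun a, by
    have h : ContDiff ℝ ∞ fun x : Fin n → ℝ =>
        Complex.exp (Complex.I * ∑ j, (a j : ℂ) * (x j : ℂ)) := by
      refine ContDiff.cexp (contDiff_const.mul (ContDiff.sum fun j _ => contDiff_const.mul ?_))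
      exact Complex.ofRealCLM.contDiff.comp (contDiff_apply ℝ ℝ j)
    exact h⟩

lemma smoothExp_apply_zero (a : Fin n → ℚ) : (smoothExp a).1 0 = 1 := by
  simp [smoothExp, expFun]

lemma smoothExp_zero : smoothExp (0 : Fin n → ℚ) = 1 := by
  ext x
  simp [smoothExp, expFun]

lemma smoothExp_add (a b : Fin n → ℚ) : smoothExp (a + b) = smoothExp a * smoothExp b := by
  ext x
  change Complex.exp _ = Complex.exp _ * Complex.exp _
  rw [← Complex.exp_add, ← mul_add, ← Finset.sum_add_distrib]
  simp [add_mul]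

lemma partialDeriv_smoothExp (j : Fin n) (a : Fin n → ℚ) :
    partialDeriv j (smoothExp a) = (Complex.I * a j : ℂ) • smoothExp a := by
  ext x
  obtain ⟨L, hL, h⟩ := hasFDerivAt_expFun a x
  change fderiv ℝ (expFun a) x (Pi.single j 1) = _
  rw [hL.fderiv, h]
  rfl

/-- The polynomial `∂ⱼ - i aⱼ`. -/
def shiftX (a : Fin n → ℚ) (j : Fin n) : Diff n := X j - C (Complex.I * a j)

lemma shiftX_smul (a : Fin n → ℚ) (j : Fin n) (f : smooth n) :
    shiftX a j • f = partialDeriv j f - (Complex.I * a j : ℂ) • f := by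
  rw [shiftX, sub_smul, X_smul, C_smul]

/-- The maximal ideal of `𝒟` at the point `i a`. -/
def pointIdeal (a : Fin n → ℚ) : Ideal (Diff n) := Ideal.span (Set.range (shiftX a))

lemma shiftX_mem (a : Fin n → ℚ) (j : Fin n) : shiftX a j ∈ pointIdeal a :=
  Ideal.subset_span ⟨j, rfl⟩

/-- Conjugation by an exponential translates the spectrum: multiplying by e^{i⟨b,x⟩} moves
nilpotency from a to a + b. -/
lemma shiftX_smul_mul_smoothExp (a b : Fin n → ℚ) (j : Fin n) (f : smooth n) :
    shiftX (a + b) j • (f * smoothExp b) = (shiftX a j • f) * smoothExp b := by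
  rw [shiftX_smul, shiftX_smul, partialDeriv_mul, partialDeriv_smoothExp, mul_smul_comm, sub_mul,
    smul_mul_assoc, Pi.add_apply]
  push_cast
  rw [mul_add, add_smul]
  abel

/-- The commutator of ∂ⱼ - i aⱼ with x_l is the Kronecker delta, so a factor x_l costs one extra
order of nilpotency. -/
lemma shiftX_smul_mul_coord (a : Fin n → ℚ) (j l : Fin n) (f : smooth n) :
    shiftX a j • (f * coord l) = (shiftX a j • f) * coord l + (if l = j then 1 else 0 : ℂ) • f := by
  rw [shiftX_smul, shiftX_smul, partialDeriv_mul, partialDeriv_coord, sub_mul, smul_mul_assoc,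
    Algebra.algebraMap_eq_smul_one, mul_smul_comm, mul_one]
  abel

/-! ### Annihilators of elements of F[x] -/

/-- `f` is killed by all products of `k` operators of the form `∂ⱼ - i aⱼ`. -/
def NilpotentAt (a : Fin n → ℚ) : ℕ → smooth n → Prop
  | 0, f => f = 0
  | k + 1, f => ∀ j, NilpotentAt a k (shiftX a j • f)

lemma NilpotentAt.zero (a : Fin n → ℚ) (k : ℕ) : NilpotentAt a k 0 := by
  induction k with
  | zero => exact rfl
  | succ k ih => intro j; rwa [smul_zero]

lemma NilpotentAt.add {a : Fin n → ℚ} {k : ℕ} {f g : smooth n} (hf : NilpotentAt a k f)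
    (hg : NilpotentAt a k g) : NilpotentAt a k (f + g) := by
  induction k generalizing f g with
  | zero => simp_all [NilpotentAt]
  | succ k ih => intro j; rw [smul_add]; exact ih (hf j) (hg j)

lemma NilpotentAt.smul {a : Fin n → ℚ} {k : ℕ} {f : smooth n} (hf : NilpotentAt a k f)
    (c : ℂ) : NilpotentAt a k (c • f) := by
  induction k generalizing f with
  | zero => simp_all [NilpotentAt]
  | succ k ih => intro j; rw [smul_smul_comm]; exact ih (hf j)

lemma NilpotentAt.mul_smoothExp {a : Fin n → ℚ} {k : ℕ} {f : smooth n} (hf : NilpotentAt a k f)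
    (b : Fin n → ℚ) : NilpotentAt (a + b) k (f * smoothExp b) := by
  induction k generalizing f with
  | zero => simp_all [NilpotentAt]
  | succ k ih => intro j; rw [shiftX_smul_mul_smoothExp]; exact ih (hf j)

lemma NilpotentAt.mul_coord {a : Fin n → ℚ} {k : ℕ} {f : smooth n} (hf : NilpotentAt a k f)
    (l : Fin n) : NilpotentAt a (k + 1) (f * coord l) := by
  induction k generalizing f with
  | zero =>
    rw [show f = 0 from hf, zero_mul]
    exact NilpotentAt.zero a _
  | succ k ih => intro j; rw [shiftX_smul_mul_coord]; exact (ih (hf j)).add (hf.smul _)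

/-- Testing generators suffices: split 𝔪_a^(k+1) as 𝔪_a^k · 𝔪_a, let a generator from the last
factor act first, and induct. -/
lemma NilpotentAt.smul_eq_zero {a : Fin n → ℚ} {k : ℕ} {f : smooth n} (hf : NilpotentAt a k f)
    {r : Diff n} (hr : r ∈ pointIdeal a ^ k) : r • f = 0 := by
  induction k generalizing f r with
  | zero => rw [show f = 0 from hf, smul_zero]
  | succ k ih =>
    rw [pow_succ] at hr
    induction hr using Submodule.mul_induction_on' with
    | mem_mul_mem s hs t ht =>
      induction ht using Submodule.span_induction generalizing s with
      | mem t ht =>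
        obtain ⟨j, rfl⟩ := ht
        rw [mul_smul]
        exact ih (hf j) hs
      | zero => rw [mul_zero, zero_smul]
      | add t u _ _ ht hu => rw [mul_add, add_smul, ht s hs, hu s hs, add_zero]
      | smul c t _ ht =>
        rw [smul_eq_mul, ← mul_assoc]
        exact ht _ (Ideal.mul_mem_right c _ hs)
    | add r _ s _ hr hs => rw [add_smul, hr, hs, add_zero]

/-- The ideal `∏_{a ∈ S} 𝔪_a^k`. -/
def fatIdeal (S : Finset (Fin n → ℚ)) (k : ℕ) : Ideal (Diff n) := ∏ a ∈ S, pointIdeal a ^ k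

lemma fatIdeal_anti {S T : Finset (Fin n → ℚ)} {k l : ℕ} (hST : S ⊆ T) (hkl : k ≤ l) :
    fatIdeal T l ≤ fatIdeal S k :=
  Ideal.le_of_dvd <| (Finset.prod_dvd_prod_of_dvd _ _ fun a _ => pow_dvd_pow (pointIdeal a) hkl).trans
    (Finset.prod_dvd_prod_of_subset S T _ hST)

lemma fatIdeal_pow (S : Finset (Fin n → ℚ)) (k l : ℕ) :
    fatIdeal S k ^ l = fatIdeal S (k * l) := by
  simp only [fatIdeal, ← Finset.prod_pow, pow_mul]

/-- `F` is spanned by the exponentials with frequencies in the monoid `A`. -/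
structure IsExpSpan (A : AddSubmonoid (Fin n → ℚ)) (F : Submodule (Diff n) (smooth n)) : Prop where
  smoothExp_mem : ∀ a ∈ A, smoothExp a ∈ F
  mem_span : ∀ f ∈ F, f ∈ Submodule.span ℂ (smoothExp '' (A : Set (Fin n → ℚ)))

variable {A : AddSubmonoid (Fin n → ℚ)} {F : Submodule (Diff n) (smooth n)}

/-- Every element of `F[x₁, …, xₙ]` is killed by a product of powers of maximal ideals. -/
lemma IsExpSpan.exists_fatIdeal_smul_eq_zero (hF : IsExpSpan A F) {f : smooth n}
    (hf : f ∈ adjoinCoords F) :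
    ∃ (S : Finset (Fin n → ℚ)) (k : ℕ), ↑S ⊆ (A : Set (Fin n → ℚ)) ∧
      ∀ r ∈ fatIdeal S k, r • f = 0 := by
  classical
  let U : Set (smooth n) := smoothExp '' (A : Set (Fin n → ℚ)) ∪ Set.range (coord (n := n))
  have hU : Algebra.adjoin ℂ ((F : Set (smooth n)) ∪ Set.range (coord (n := n)))
      ≤ Algebra.adjoin ℂ U := by
    refine Algebra.adjoin_le ?_
    rintro g (hg | hg)
    · have h : Submodule.span ℂ (smoothExp '' (A : Set (Fin n → ℚ)))
          ≤ Subalgebra.toSubmodule (Algebra.adjoin ℂ U) :=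
        Submodule.span_le.mpr fun g hg => Algebra.subset_adjoin (Or.inl hg)
      exact h (hF.mem_span g hg)
    · exact Algebra.subset_adjoin (Or.inr hg)
  have hf' : f ∈ Subalgebra.toSubmodule (Algebra.adjoin ℂ U) := hU hf
  -- An algebra is the linear span of the monomials in its generators, and each monomial is
  -- nilpotent at the sum of the frequencies of its exponential factors.
  rw [Algebra.adjoin_eq_span] at hf'
  clear hf
  have hmon : ∀ g ∈ Submonoid.closure U, ∃ a ∈ A, ∃ k, NilpotentAt a k g := by
    intro g hg
    induction hg using Submonoid.closure_induction_right with
    | one =>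
      refine ⟨0, A.zero_mem, 1, fun j => ?_⟩
      rw [← smoothExp_zero, shiftX_smul, partialDeriv_smoothExp, sub_self]
      exact NilpotentAt.zero _ _
    | mul_right x hx y hy ih =>
      obtain ⟨a, ha, k, hk⟩ := ih
      rcases hy with ⟨b, hb, rfl⟩ | ⟨l, rfl⟩
      · exact ⟨a + b, A.add_mem ha hb, k, hk.mul_smoothExp b⟩
      · exact ⟨a, ha, k + 1, hk.mul_coord l⟩
  induction hf' using Submodule.span_induction with
  | mem g hg =>
    obtain ⟨a, ha, k, hk⟩ := hmon g hg
    refine ⟨{a}, k, by simpa using ha, fun r hr => hk.smul_eq_zero ?_⟩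
    simpa [fatIdeal] using hr
  | zero => exact ⟨∅, 0, by simp, fun r _ => smul_zero r⟩
  | add g h _ _ hg hh =>
    obtain ⟨S, k, hS, hk⟩ := hg
    obtain ⟨T, l, hT, hl⟩ := hh
    refine ⟨S ∪ T, max k l, by simp [hS, hT], fun r hr => ?_⟩
    rw [smul_add, hk r (fatIdeal_anti Finset.subset_union_left (le_max_left _ _) hr),
      hl r (fatIdeal_anti Finset.subset_union_right (le_max_right _ _) hr), add_zero]
  | smul c g _ hg =>
    obtain ⟨S, k, hS, hk⟩ := hg
    exact ⟨S, k, hS, fun r hr => by rw [smul_smul_comm, hk r hr, smul_zero]⟩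

/-! ### Jets at the origin and their duality with x^α e^{i⟨a,x⟩} -/

/-- The functional `P ↦ (P f)(0)` on `𝒟`. -/
def jetAtZero (f : smooth n) : Diff n →ₗ[ℂ] ℂ where
  toFun P := (P • f).1 0
  map_add' P Q := by rw [add_smul]; rfl
  map_smul' c P := by rw [smul_eq_C_mul, mul_smul, C_smul]; rfl

lemma jetAtZero_apply (f : smooth n) (P : Diff n) : jetAtZero f P = (P • f).1 0 := rfl

lemma jetAtZero_add (f g : smooth n) : jetAtZero (f + g) = jetAtZero f + jetAtZero g := by
  refine LinearMap.ext fun P => ?_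
  change (P • (f + g)).1 0 = _
  rw [smul_add]
  rfl

lemma jetAtZero_zero : jetAtZero (0 : smooth n) = 0 := by
  refine LinearMap.ext fun P => ?_
  change (P • (0 : smooth n)).1 0 = _
  rw [smul_zero]
  rfl

lemma jetAtZero_smul (P : Diff n) (f : smooth n) (Q : Diff n) :
    jetAtZero (P • f) Q = jetAtZero f (P * Q) := by
  rw [jetAtZero_apply, jetAtZero_apply, smul_smul, mul_comm]

lemma jetAtZero_const_smul (c : ℂ) (f : smooth n) : jetAtZero (c • f) = c • jetAtZero f := by
  refine LinearMap.ext fun P => ?_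
  change (P • (c • f)).1 0 = _
  rw [smul_smul_comm]
  rfl

/-- A polynomial in the coordinates, as a smooth function. -/
def polyFun : MvPolynomial (Fin n) ℂ →ₐ[ℂ] smooth n := aeval coord

lemma polyFun_apply_zero (p : MvPolynomial (Fin n) ℂ) : (polyFun p).1 0 = constantCoeff p := by
  induction p using MvPolynomial.induction_on with
  | C c => rw [polyFun, aeval_C, constantCoeff_C]; rfl
  | add p q hp hq => rw [map_add, map_add, ← hp, ← hq]; rfl
  | mul_X p j hp =>
    rw [map_mul, map_mul, constantCoeff_X, mul_zero, polyFun, aeval_X]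
    change _ * ((0 : ℝ) : ℂ) = 0
    simp

lemma partialDeriv_polyFun (j : Fin n) (p : MvPolynomial (Fin n) ℂ) :
    partialDeriv j (polyFun p) = polyFun (pderiv j p) := by
  induction p using MvPolynomial.induction_on with
  | C c => rw [polyFun, aeval_C, pderiv_C, map_zero, partialDeriv_algebraMap]
  | add p q hp hq => rw [map_add, map_add, hp, hq, map_add, map_add]
  | mul_X p l hp =>
    have hX : polyFun (X l : MvPolynomial (Fin n) ℂ) = coord l := aeval_X _ _
    rw [map_mul, partialDeriv_mul, hp, pderiv_mul, map_add, map_mul, map_mul, hX,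
      partialDeriv_coord, pderiv_X]
    congr 2
    by_cases h : l = j
    · subst h; simp
    · simp [h]

lemma shiftX_smul_polyFun_mul (a : Fin n → ℚ) (j : Fin n) (p : MvPolynomial (Fin n) ℂ) :
    shiftX a j • (polyFun p * smoothExp a) = polyFun (pderiv j p) * smoothExp a := by
  have h := shiftX_smul_mul_smoothExp 0 a j (polyFun p)
  rw [zero_add] at h
  rw [h, shiftX_smul, partialDeriv_polyFun]
  simp

/-- The algebra endomorphism `∂ⱼ ↦ ∂ⱼ - i aⱼ` of `𝒟`. -/
def shiftHom (a : Fin n → ℚ) : Diff n →ₐ[ℂ] Diff n := aeval (shiftX a)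

lemma shiftHom_surjective (a : Fin n → ℚ) : Function.Surjective (shiftHom a) := by
  intro p
  refine ⟨aeval (fun j => X j + C (Complex.I * a j)) p, ?_⟩
  have h : (shiftHom a).comp (aeval (fun j => X j + C (Complex.I * (a j : ℂ))))
      = AlgHom.id ℂ (Diff n) := by
    ext1 j
    simp [shiftHom, shiftX, ← algebraMap_eq]
  exact DFunLike.congr_fun h p

lemma shiftHom_monomial_add_single (a : Fin n → ℚ) (β : Fin n →₀ ℕ) (j : Fin n) :
    shiftHom a (monomial (β + Finsupp.single j 1) 1) = shiftHom a (monomial β 1) * shiftX a j := by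
  rw [monomial_add_single, pow_one, map_mul]
  congr 1
  exact aeval_X _ _

lemma exists_eq_add_single_of_ne_zero {β : Fin n →₀ ℕ} {j : Fin n} (h : β j ≠ 0) :
    ∃ γ, β = γ + Finsupp.single j 1 := by
  refine ⟨β - Finsupp.single j 1, (tsub_add_cancel_of_le ?_).symm⟩
  rw [Finsupp.single_le_iff]
  omega

lemma shiftHom_monomial_mem (a : Fin n → ℚ) (β : Fin n →₀ ℕ) :
    shiftHom a (monomial β 1) ∈ pointIdeal a ^ β.degree := by
  induction hd : β.degree generalizing β with
  | zero => simp
  | succ d ih =>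
    obtain ⟨j, hj⟩ : ∃ j, β j ≠ 0 := by
      by_contra! h
      have : β = 0 := Finsupp.ext h
      simp [this] at hd
    obtain ⟨γ, rfl⟩ := exists_eq_add_single_of_ne_zero hj
    rw [shiftHom_monomial_add_single, pow_succ]
    exact Ideal.mul_mem_mul (ih γ (by simpa using hd)) (shiftX_mem a j)

/-- The monomials `(∂ - i a)^β` and `x^α e^{i⟨a,x⟩}` are dual to each other up to nonzero factors. -/
lemma jetAtZero_monomial_ne_zero_iff (a : Fin n → ℚ) (α β : Fin n →₀ ℕ) :
    jetAtZero (polyFun (monomial α 1) * smoothExp a) (shiftHom a (monomial β 1)) ≠ 0 ↔ α = β := by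
  induction hd : β.degree generalizing α β with
  | zero =>
    obtain rfl : β = 0 := (Finsupp.degree_eq_zero_iff β).mp hd
    rw [show monomial (0 : Fin n →₀ ℕ) (1 : ℂ) = 1 from rfl, map_one (shiftHom a), jetAtZero_apply,
      one_smul]
    change (polyFun (monomial α 1)).1 0 * (smoothExp a).1 0 ≠ 0 ↔ _
    rw [polyFun_apply_zero, smoothExp_apply_zero, mul_one, constantCoeff_monomial]
    simp
  | succ d ih =>
    obtain ⟨j, hj⟩ : ∃ j, β j ≠ 0 := by
      by_contra! h
      have : β = 0 := Finsupp.ext h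
      simp [this] at hd
    obtain ⟨γ, rfl⟩ := exists_eq_add_single_of_ne_zero hj
    rw [shiftHom_monomial_add_single, mul_comm (shiftHom a _), ← jetAtZero_smul, shiftX_smul_polyFun_mul,
      pderiv_monomial, one_mul]
    -- If x_j does not occur, the derivative is zero. Otherwise it lowers both exponents by one, and
    -- the factor α j is nonzero in ℂ.
    by_cases hα : α j = 0
    · rw [hα]
      have : α ≠ γ + Finsupp.single j 1 := by
        rintro rfl
        simp at hα
      simp [this, jetAtZero_zero]
    · obtain ⟨δ, rfl⟩ := exists_eq_add_single_of_ne_zero hα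
      rw [add_tsub_cancel_right, ← mul_one (Nat.cast _),
        ← smul_eq_mul (a := (Nat.cast _ : ℂ)), ← smul_monomial, map_smul, smul_mul_assoc, jetAtZero_const_smul, LinearMap.smul_apply,
        smul_ne_zero_iff, ih δ γ (by simpa using hd), add_left_inj]
      exact and_iff_right (Nat.cast_ne_zero.mpr hα)

/-! ### Realizing functionals on 𝒟 by elements of F[x] -/

lemma IsExpSpan.polyFun_mul_smoothExp_mem (hF : IsExpSpan A F) {a : Fin n → ℚ} (ha : a ∈ A)
    (p : MvPolynomial (Fin n) ℂ) : polyFun p * smoothExp a ∈ adjoinCoords F := by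
  refine Subalgebra.mul_mem (Algebra.adjoin ℂ ((F : Set (smooth n)) ∪ Set.range coord)) ?_
    (Algebra.subset_adjoin (Or.inl (hF.smoothExp_mem a ha)))
  refine Algebra.adjoin_mono (s := Set.range coord) Set.subset_union_right ?_
  rw [Algebra.adjoin_range_eq_range_aeval]
  exact ⟨p, rfl⟩

lemma const_smul_mem (E : Submodule (Diff n) (smooth n)) (c : ℂ) {f : smooth n} (hf : f ∈ E) :
    c • f ∈ E := by
  rw [← C_smul]
  exact E.smul_mem _ hf

/-- A functional on `𝒟` that kills a power of the maximal ideal at `i a` comes from an element of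
`F[x₁, …, xₙ]`. -/
lemma IsExpSpan.exists_jetAtZero_eq_of_pointIdeal (hF : IsExpSpan A F) {a : Fin n → ℚ}
    (ha : a ∈ A) (k : ℕ) (μ : Diff n →ₗ[ℂ] ℂ) (hμ : ∀ r ∈ pointIdeal a ^ k, μ r = 0) :
    ∃ e ∈ adjoinCoords F, jetAtZero e = μ := by
  classical
  -- Degrees below `k` would suffice; including degree `k` is harmless.
  let T : Finset (Fin n →₀ ℕ) := (Finsupp.finite_of_degree_le (σ := Fin n) k).toFinset
  let g : (Fin n →₀ ℕ) → smooth n := fun α => polyFun (monomial α 1) * smoothExp a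
  let Y : (Fin n →₀ ℕ) → Diff n := fun β => shiftHom a (monomial β 1)
  -- Expansion of μ in the dual family, each term divided by its own nonzero diagonal pairing.
  let e : smooth n := ∑ α ∈ T, (μ (Y α) / jetAtZero (g α) (Y α)) • g α
  have he : ∀ P, jetAtZero e P = ∑ α ∈ T, (μ (Y α) / jetAtZero (g α) (Y α)) * jetAtZero (g α) P := by
    let J : smooth n →+ (Diff n →ₗ[ℂ] ℂ) :=
      { toFun := jetAtZero, map_zero' := jetAtZero_zero, map_add' := jetAtZero_add }
    intro P
    change J e P = _
    rw [map_sum, LinearMap.sum_apply]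
    refine Finset.sum_congr rfl fun α _ => ?_
    change jetAtZero _ P = _
    rw [jetAtZero_const_smul]
    rfl
  refine ⟨e, Submodule.sum_mem _ fun α _ =>
    const_smul_mem _ _ (hF.polyFun_mul_smoothExp_mem ha _), ?_⟩
  have hY : ∀ β, jetAtZero e (Y β) = μ (Y β) := by
    intro β
    have h0 : ∀ α, α ≠ β → jetAtZero (g α) (Y β) = 0 := fun α h => by
      by_contra h'
      exact h ((jetAtZero_monomial_ne_zero_iff a α β).mp h')
    rw [he]
    by_cases hβ : β ∈ T
    · rw [Finset.sum_eq_single_of_mem β hβ fun α _ h => by rw [h0 α h, mul_zero]]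
      exact div_mul_cancel₀ _ ((jetAtZero_monomial_ne_zero_iff a β β).mpr rfl)
    -- Beyond `T` both functionals vanish: μ because (∂ - i a)^β lies in 𝔪_a^k, the jet of `e` by
    -- orthogonality.
    · have hk : k ≤ β.degree := by
        by_contra h
        exact hβ (by simpa [T] using (not_le.mp h).le)
      rw [hμ _ (Ideal.pow_le_pow_right hk (shiftHom_monomial_mem a β))]
      refine Finset.sum_eq_zero fun α hα => ?_
      rw [h0 α (by rintro rfl; exact hβ hα), mul_zero]
  refine LinearMap.ext fun P => ?_
  obtain ⟨Q, rfl⟩ := shiftHom_surjective a P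
  have hlin : jetAtZero e ∘ₗ (shiftHom a).toLinearMap = μ ∘ₗ (shiftHom a).toLinearMap :=
    (basisMonomials (Fin n) ℂ).ext fun β => by simpa using hY β
  exact DFunLike.congr_fun hlin Q

/-- If aⱼ ≠ bⱼ, the difference of the two generators with index j is the nonzero constant i(bⱼ -
aⱼ). -/
lemma isCoprime_pointIdeal {a b : Fin n → ℚ} (h : a ≠ b) :
    IsCoprime (pointIdeal a) (pointIdeal b) := by
  obtain ⟨j, hj⟩ := Function.ne_iff.mp h
  rw [Ideal.isCoprime_iff_sup_eq, Ideal.eq_top_iff_one]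
  have hc : Complex.I * ((b j : ℂ) - a j) ≠ 0 :=
    mul_ne_zero Complex.I_ne_zero (sub_ne_zero.mpr fun h => hj (by exact_mod_cast h.symm))
  have h1 : (1 : Diff n) =
      C (Complex.I * ((b j : ℂ) - a j))⁻¹ * (shiftX a j - shiftX b j) := by
    rw [shiftX, shiftX, sub_sub_sub_cancel_left, ← C_sub, ← mul_sub, ← C_mul, inv_mul_cancel₀ hc,
      C_1]
  rw [h1]
  exact Ideal.mul_mem_left _ _ (Ideal.sub_mem _ (Ideal.mem_sup_left (shiftX_mem a j))
    (Ideal.mem_sup_right (shiftX_mem b j)))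

/-- Chinese remainder theorem in dual form: with u + v = 1, u in 𝔪_a^k and v in the product over the
other points, μ is the sum of P ↦ μ(P v), which kills 𝔪_a^k, and P ↦ μ(u P), which kills the other
product. -/
lemma IsExpSpan.exists_jetAtZero_eq (hF : IsExpSpan A F) {S : Finset (Fin n → ℚ)}
    (hS : ↑S ⊆ (A : Set (Fin n → ℚ))) (k : ℕ) (μ : Diff n →ₗ[ℂ] ℂ)
    (hμ : ∀ r ∈ fatIdeal S k, μ r = 0) :
    ∃ e ∈ adjoinCoords F, jetAtZero e = μ := by
  classical
  induction S using Finset.induction_on generalizing μ with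
  | empty =>
    refine ⟨0, Submodule.zero_mem _, ?_⟩
    rw [jetAtZero_zero]
    refine LinearMap.ext fun P => ?_
    exact (hμ P (by simp [fatIdeal])).symm
  | insert a S ha ih =>
    have hco : IsCoprime (pointIdeal a ^ k) (fatIdeal S k) :=
      IsCoprime.prod_right fun b hb =>
        (isCoprime_pointIdeal (by rintro rfl; exact ha hb)).pow
    obtain ⟨u, hu, v, hv, huv⟩ := Ideal.isCoprime_iff_exists.mp hco
    have hprod : fatIdeal (insert a S) k = pointIdeal a ^ k * fatIdeal S k :=
      Finset.prod_insert ha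
    rw [hprod] at hμ
    rw [Finset.coe_insert, Set.insert_subset_iff] at hS
    obtain ⟨e, he, hev⟩ := hF.exists_jetAtZero_eq_of_pointIdeal hS.1 k (μ ∘ₗ LinearMap.mulRight ℂ v)
      fun r hr => hμ _ (Ideal.mul_mem_mul hr hv)
    obtain ⟨e', he', heu⟩ := ih hS.2 (μ ∘ₗ LinearMap.mulLeft ℂ u)
      fun r hr => hμ _ (Ideal.mul_mem_mul hu hr)
    refine ⟨e + e', Submodule.add_mem _ he he', ?_⟩
    rw [jetAtZero_add, hev, heu]
    refine LinearMap.ext fun P => ?_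
    change μ (P * v) + μ (u * P) = μ P
    rw [← map_add, mul_comm u, ← mul_add, add_comm v, huv, mul_one]

/-! ### Exponentials in nonzero submodules -/

/-- A joint eigenvector of the `∂ⱼ` with eigenvalues `i aⱼ` is a multiple of `e^{i⟨a,x⟩}`. -/
lemma exists_eq_smul_smoothExp {a : Fin n → ℚ} {g : smooth n} (hg : ∀ j, shiftX a j • g = 0) :
    ∃ c : ℂ, g = c • smoothExp a := by
  -- Untwisting by e^{-i⟨a,x⟩} turns the eigenvector equations into the vanishing of all partial
  -- derivatives.
  set h : smooth n := g * smoothExp (-a) with hh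
  have hd : ∀ j, partialDeriv j h = 0 := by
    intro j
    have := shiftX_smul_mul_smoothExp a (-a) j g
    rw [hg j, zero_mul, ← hh, add_neg_cancel, shiftX_smul] at this
    simpa using this
  have hf : ∀ x, fderiv ℝ h.1 x = 0 := by
    intro x
    ext y
    have := LinearMap.pi_apply_eq_sum_univ (fderiv ℝ h.1 x).toLinearMap y
    refine this.trans (Finset.sum_eq_zero fun j _ => ?_)
    have hj : fderiv ℝ h.1 x (Pi.single j 1) = 0 := by
      rw [← partialDeriv_apply, hd j]
      rfl
    have he : (fun i => if j = i then (1 : ℝ) else 0) = Pi.single j 1 := by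
      ext i
      simp [Pi.single_apply, eq_comm]
    rw [he]
    exact smul_eq_zero_of_right _ hj
  have hc := is_const_of_fderiv_eq_zero (fun x => differentiableAt_smooth h x) hf
  have hh' : h = (h.1 0) • 1 := by
    ext x
    change h.1 x = h.1 0 * 1
    rw [mul_one]
    exact hc x 0
  refine ⟨h.1 0, ?_⟩
  calc g = h * smoothExp a := by
        rw [hh, mul_assoc, ← smoothExp_add, neg_add_cancel, smoothExp_zero, mul_one]
    _ = _ := by
        conv_lhs => rw [hh']
        rw [smul_mul_assoc, one_mul]

lemma IsExpSpan.exists_smoothExp_mem (hF : IsExpSpan A F) {S : Submodule (Diff n) (smooth n)}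
    (hS : S ≤ adjoinCoords F) (h0 : S ≠ ⊥) : ∃ a ∈ A, smoothExp a ∈ S := by
  obtain ⟨f, hf, hf0⟩ := Submodule.exists_mem_ne_zero_of_ne_bot h0
  obtain ⟨T, k, hT, hk⟩ := hF.exists_fatIdeal_smul_eq_zero (hS hf)
  -- Since 𝒟 is Noetherian, the annihilator of `f` lies in an associated prime of `S`. Being prime,
  -- it contains some 𝔪_a, and the element `g` that it annihilates is the desired eigenvector.
  obtain ⟨P, hP, hle⟩ := exists_le_isAssociatedPrime_of_isNoetherianRing (Diff n)
    (⟨f, hf⟩ : S) (fun h => hf0 (congrArg Subtype.val h))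
  obtain ⟨hprime, g, hg⟩ := isAssociatedPrime_iff.mp hP
  have hTP : fatIdeal T k ≤ P := fun r hr => hle <| by
    rw [Submodule.mem_colon_singleton, Submodule.mem_bot]
    exact Subtype.ext (hk r hr)
  obtain ⟨a, ha, haP⟩ := hprime.prod_le.mp hTP
  have haP' : pointIdeal a ≤ P := hprime.le_of_pow_le haP
  have hga : ∀ j, shiftX a j • g.1 = 0 := fun j => by
    have := haP' (shiftX_mem a j)
    rw [hg, Submodule.mem_colon_singleton, Submodule.mem_bot] at this
    exact congrArg Subtype.val this
  obtain ⟨c, hc⟩ := exists_eq_smul_smoothExp hga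
  have hc0 : c ≠ 0 := by
    rintro rfl
    rw [zero_smul] at hc
    apply hprime.ne_top
    rw [hg, Ideal.eq_top_iff_one, Submodule.mem_colon_singleton, one_smul, Submodule.mem_bot]
    exact Subtype.ext hc
  refine ⟨a, hT ha, ?_⟩
  have := const_smul_mem S c⁻¹ g.2
  rwa [hc, smul_smul, inv_mul_cancel₀ hc0, one_smul] at this

lemma IsExpSpan.eq_zero_of_jetAtZero (hF : IsExpSpan A F) {f : smooth n}
    (hf : f ∈ adjoinCoords F) (h : jetAtZero f = 0) : f = 0 := by
  by_contra hf0
  obtain ⟨a, -, ha⟩ := hF.exists_smoothExp_mem (S := Submodule.span (Diff n) {f})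
    ((Submodule.span_singleton_le_iff_mem _ _).mpr hf) (by simpa using hf0)
  obtain ⟨P, hP⟩ := Submodule.mem_span_singleton.mp ha
  have h1 := smoothExp_apply_zero a
  rw [← hP, ← jetAtZero_apply, h] at h1
  exact zero_ne_one h1

/-! ### Baer's criterion via Artin–Rees -/

lemma IsExpSpan.exists_fatIdeal_of_fg (hF : IsExpSpan A F) {N : Submodule (Diff n) (smooth n)}
    (hN : N ≤ adjoinCoords F) (hfg : N.FG) :
    ∃ (S : Finset (Fin n → ℚ)) (k : ℕ), ↑S ⊆ (A : Set (Fin n → ℚ)) ∧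
      ∀ r ∈ fatIdeal S k, ∀ f ∈ N, r • f = 0 := by
  classical
  induction N, hfg using Submodule.fg_induction with
  | singleton f =>
    obtain ⟨S, k, hS, hk⟩ := hF.exists_fatIdeal_smul_eq_zero
      (hN (Submodule.mem_span_singleton_self f))
    refine ⟨S, k, hS, fun r hr g hg => ?_⟩
    obtain ⟨P, rfl⟩ := Submodule.mem_span_singleton.mp hg
    rw [smul_comm, hk r hr, smul_zero]
  | sup N₁ N₂ _ _ h₁ h₂ =>
    obtain ⟨S, k, hS, hk⟩ := h₁ (le_sup_left.trans hN)
    obtain ⟨T, l, hT, hl⟩ := h₂ (le_sup_right.trans hN)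
    refine ⟨S ∪ T, max k l, by simp [hS, hT], fun r hr f hf => ?_⟩
    obtain ⟨g, hg, h, hh, rfl⟩ := Submodule.mem_sup.mp hf
    rw [smul_add, hk r (fatIdeal_anti Finset.subset_union_left (le_max_left _ _) hr) g hg,
      hl r (fatIdeal_anti Finset.subset_union_right (le_max_right _ _) hr) h hh, add_zero]

/-- A functional on an ideal `I` that vanishes on `I ⊓ J` extends to one that vanishes on `J`. -/
lemma exists_extend_of_inf_le {R : Type*} [CommRing R] [Algebra ℂ R] (I J : Ideal R)
    (μ : I →ₗ[ℂ] ℂ) (hμ : ∀ x : I, (x : R) ∈ J → μ x = 0) :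
    ∃ ν : R →ₗ[ℂ] ℂ, (∀ x : I, ν x = μ x) ∧ ∀ r ∈ J, ν r = 0 := by
  let q : I →ₗ[ℂ] R ⧸ J := (Ideal.Quotient.mkₐ ℂ J).toLinearMap ∘ₗ I.subtype.restrictScalars ℂ
  have h : μ ∈ LinearMap.range q.dualMap := by
    -- A functional that vanishes on the kernel of I → R/J factors through the image, and over a
    -- field it extends to all of R/J.
    rw [LinearMap.range_dualMap_eq_dualAnnihilator_ker, Submodule.mem_dualAnnihilator]
    exact fun x hx => hμ x (Ideal.Quotient.eq_zero_iff_mem.mp hx)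
  obtain ⟨ν, rfl⟩ := h
  refine ⟨ν ∘ₗ (Ideal.Quotient.mkₐ ℂ J).toLinearMap, fun x => rfl, fun r hr => ?_⟩
  change ν (Ideal.Quotient.mk J r) = 0
  rw [Ideal.Quotient.eq_zero_iff_mem.mpr hr, map_zero]

lemma map_eq_zero_of_mem_mul {R M : Type*} [CommRing R] [AddCommGroup M] [Module R M]
    {I J : Ideal R} (φ : I →ₗ[R] M) (hφ : ∀ s ∈ J, ∀ y, s • φ y = 0) {x : I}
    (hx : (x : R) ∈ J * I) : φ x = 0 := by
  have h : J * I ≤ (LinearMap.ker φ).map I.subtype := by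
    refine Ideal.mul_le.mpr fun s hs t ht => ⟨s • ⟨t, ht⟩, ?_, rfl⟩
    change φ (s • ⟨t, ht⟩) = 0
    rw [map_smul, hφ s hs]
  obtain ⟨y, hy, hyx⟩ := h hx
  obtain rfl : y = x := Subtype.ext hyx
  exact hy

/-- Linear maps from an ideal to `F[x₁, …, xₙ]` are given by an element of `F[x₁, …, xₙ]`. -/
lemma IsExpSpan.exists_forall_eq_smul (hF : IsExpSpan A F) (I : Ideal (Diff n))
    (φ : I →ₗ[Diff n] smooth n) (hφ : ∀ x, φ x ∈ adjoinCoords F) :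
    ∃ e ∈ adjoinCoords F, ∀ x : I, φ x = (x : Diff n) • e := by
  obtain ⟨S, k, hS, hk⟩ := hF.exists_fatIdeal_of_fg (N := LinearMap.range φ)
    (by rintro _ ⟨x, rfl⟩; exact hφ x)
    (by
      rw [LinearMap.range_eq_map]
      exact (Module.Finite.fg_top (R := Diff n) (M := I)).map _)
  -- Artin–Rees; the exponent m + 1 leaves exactly one factor of the ideal in front.
  obtain ⟨m, hm⟩ := Ideal.exists_pow_inf_eq_pow_smul (fatIdeal S k) I
  have hAR : fatIdeal S k ^ (m + 1) ⊓ I ≤ fatIdeal S k * I := by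
    have := hm (m + 1) (Nat.le_succ m)
    rw [smul_eq_mul, Ideal.mul_top, Nat.add_sub_cancel_left, pow_one] at this
    rw [this]
    exact Ideal.mul_mono_right inf_le_right
  let μ : I →ₗ[ℂ] ℂ :=
    { toFun := fun x => (φ x).1 0
      map_add' := fun x y => by rw [φ.map_add]; rfl
      map_smul' := fun c x => by
        have : c • x = (C c : Diff n) • x := Subtype.ext (smul_eq_C_mul _ _)
        rw [this, φ.map_smul, C_smul]
        rfl }
  obtain ⟨ν, hνI, hνJ⟩ := exists_extend_of_inf_le I (fatIdeal S k ^ (m + 1)) μ fun x hx => by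
    change (φ x).1 0 = 0
    rw [map_eq_zero_of_mem_mul φ (fun s hs y => hk s hs _ ⟨y, rfl⟩) (hAR ⟨hx, x.2⟩)]
    rfl
  obtain ⟨e, he, rfl⟩ := hF.exists_jetAtZero_eq hS (k * (m + 1)) ν
    (by rwa [← fatIdeal_pow])
  refine ⟨e, he, fun x => sub_eq_zero.mp (hF.eq_zero_of_jetAtZero
    (Submodule.sub_mem _ (hφ x) (Submodule.smul_mem _ x.1 he)) ?_)⟩
  refine LinearMap.ext fun P => ?_
  -- Linearity of φ turns the value at 0, known on all of `I`, into the whole jet of φ(x), since P x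
  -- stays in `I`.
  have h1 : jetAtZero e (P * x) = (P • φ x).1 0 := by
    rw [← φ.map_smul]
    exact hνI (P • x)
  rw [jetAtZero_apply, smul_sub, smul_smul]
  exact sub_eq_zero.mpr h1.symm

/-- `F[x₁, …, xₙ]` is an injective `𝒟`-module. -/
theorem IsExpSpan.injective (hF : IsExpSpan A F) :
    Module.Injective (Diff n) (adjoinCoords F) := by
  refine Module.Baer.injective fun I φ => ?_
  obtain ⟨e, he, h⟩ := hF.exists_forall_eq_smul I ((adjoinCoords F).subtype ∘ₗ φ) fun x => (φ x).2
  exact ⟨LinearMap.toSpanSingleton (Diff n) _ ⟨e, he⟩,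
    fun r hr => Subtype.ext (h ⟨r, hr⟩).symm⟩

theorem IsExpSpan.isInjectiveEnvelope (hF : IsExpSpan A F) :
    IsInjectiveEnvelope (R := Diff n) (M := F) (E := adjoinCoords F)
      (Submodule.inclusion (le_adjoinCoords F)) where
  injective_map := Submodule.inclusion_injective _
  injective_module := hF.injective
  essential S hS := by
    by_contra h0
    obtain ⟨a, ha, haS⟩ := hF.exists_smoothExp_mem (S := S.map (adjoinCoords F).subtype)
      (Submodule.map_subtype_le _ _)
      (fun h => h0 (Submodule.map_injective_of_injective (Submodule.subtype_injective _)
        (h.trans (Submodule.map_bot _).symm)))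
    obtain ⟨f, hf, hfa⟩ := haS
    have hmem : f ∈ S ⊓ LinearMap.range (Submodule.inclusion (le_adjoinCoords F)) :=
      ⟨hf, ⟨smoothExp a, hF.smoothExp_mem a ha⟩, Subtype.ext hfa.symm⟩
    rw [hS, Submodule.mem_bot] at hmem
    have h1 := smoothExp_apply_zero a
    rw [← hfa, hmem] at h1
    exact zero_ne_one h1

/-! ### The torus and the protorus -/

lemma isPeriodic_smoothExp {N : ℕ} {a : Fin n → ℚ} (ha : ∀ j, ∃ m : ℤ, (N : ℚ) * a j = m) :
    IsPeriodic N (smoothExp a).1 := by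
  choose l hl using ha
  intro x m
  change Complex.exp _ = Complex.exp _
  rw [Complex.exp_eq_exp_iff_exists_int]
  -- With N aⱼ = lⱼ, translation by 2πN m changes the exponent by 2πi ∑ lⱼ mⱼ.
  refine ⟨∑ j, l j * m j, ?_⟩
  push_cast
  rw [Finset.mul_sum, Finset.mul_sum, Finset.sum_mul, ← Finset.sum_add_distrib]
  refine Finset.sum_congr rfl fun j _ => ?_
  have h : (N : ℂ) * (a j : ℂ) = l j := by exact_mod_cast congrArg (Rat.cast : ℚ → ℂ) (hl j)
  rw [← h]
  ring

lemma hasFiniteSupport_smoothExp {N : ℕ} {a : Fin n → ℚ}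
    (ha : ∀ j, ∃ m : ℤ, (N : ℚ) * a j = m) : HasFiniteSupport N (smoothExp a).1 := by
  rw [hasFiniteSupport_iff]
  refine ⟨Finsupp.single a 1, fun b hb => ?_, fun x => ?_⟩
  · obtain rfl : a = b := by
      by_contra h
      exact hb (Finsupp.single_eq_of_ne (Ne.symm h))
    exact ha
  · exact ((Finsupp.sum_single_index (h := fun b z => z * expFun b x) (zero_mul _)).trans (one_mul _)).symm

lemma HasFiniteSupport.mem_span {N : ℕ} {f : smooth n} (hf : HasFiniteSupport N f.1) :
    f ∈ Submodule.span ℂ (smoothExp '' {a | ∀ j, ∃ m : ℤ, (N : ℚ) * a j = m}) := by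
  obtain ⟨c, hc, hfc⟩ := hasFiniteSupport_iff.mp hf
  have : f = ∑ a ∈ c.support, c a • smoothExp a := by
    ext x
    rw [AddSubmonoidClass.coe_finsetSum, Finset.sum_apply]
    exact hfc x
  rw [this]
  exact Submodule.sum_mem _ fun a ha => Submodule.smul_mem _ _
    (Submodule.subset_span ⟨a, hc a (Finsupp.mem_support_iff.mp ha), rfl⟩)

/-- The lattice `ℤⁿ` in `ℚⁿ`. -/
def integralFrequencies (n : ℕ) : AddSubmonoid (Fin n → ℚ) where
  carrier := {a | ∀ j, ∃ m : ℤ, ((1 : ℕ) : ℚ) * a j = m}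
  zero_mem' j := ⟨0, by simp⟩
  add_mem' {a b} ha hb j := by
    obtain ⟨l, hl⟩ := ha j
    obtain ⟨m, hm⟩ := hb j
    exact ⟨l + m, by rw [Pi.add_apply, mul_add, hl, hm]; push_cast; rfl⟩

lemma isExpSpan_torusFin : IsExpSpan (integralFrequencies n) (torusFin n) where
  smoothExp_mem _ ha := ⟨isPeriodic_smoothExp ha, hasFiniteSupport_smoothExp ha⟩
  mem_span _ hf := hf.2.mem_span

lemma exists_common_denominator (a : Fin n → ℚ) :
    ∃ N : ℕ, 1 ≤ N ∧ ∀ j, ∃ m : ℤ, (N : ℚ) * a j = m := by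
  refine ⟨∏ j, (a j).den, Finset.prod_pos fun j _ => (a j).den_pos, fun j => ?_⟩
  obtain ⟨d, hd⟩ := Finset.dvd_prod_of_mem (fun j => (a j).den) (Finset.mem_univ j)
  refine ⟨d * (a j).num, ?_⟩
  rw [hd]
  push_cast
  rw [mul_comm ((a j).den : ℚ), mul_assoc, Rat.den_mul_eq_num]

lemma isExpSpan_protorusFin : IsExpSpan ⊤ (protorusFin n) where
  smoothExp_mem a _ := by
    obtain ⟨N, hN, ha⟩ := exists_common_denominator a
    exact ⟨⟨N, hN, isPeriodic_smoothExp ha⟩, N, hN, hasFiniteSupport_smoothExp ha⟩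
  mem_span f hf := by
    obtain ⟨-, N, -, h⟩ := hf
    exact Submodule.span_mono (Set.image_mono fun a _ => trivial) h.mem_span

end PeriodicBehavior

end

theorem proposition2p1 (n : ℕ) :
    PeriodicBehavior.IsInjectiveEnvelope (R := PeriodicBehavior.Diff n)
      (M := PeriodicBehavior.protorusFin n)
      (E := PeriodicBehavior.adjoinCoords (PeriodicBehavior.protorusFin n))
      (Submodule.inclusion
        (PeriodicBehavior.le_adjoinCoords (PeriodicBehavior.protorusFin n))) ∧
    PeriodicBehavior.IsInjectiveEnvelope (R := PeriodicBehavior.Diff n)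
      (M := PeriodicBehavior.torusFin n)
      (E := PeriodicBehavior.adjoinCoords (PeriodicBehavior.torusFin n))
      (Submodule.inclusion
        (PeriodicBehavior.le_adjoinCoords (PeriodicBehavior.torusFin n))) :=
  ⟨PeriodicBehavior.isExpSpan_protorusFin.isInjectiveEnvelope,
    PeriodicBehavior.isExpSpan_torusFin.isInjectiveEnvelope⟩
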